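/- Let $k$ be a field with separable closure $K$, let $X$ be a separated, connected, normal algebraic space of finite type over $K$, and let $G\subset\operatorname{Aut}_K(X)$ be a finite group, with quotient $\pi:X\to X/G$. Write $\operatorname{Aut}_k(X)$ for the group of automorphisms of $X$ over $k$, $\mathcal N_{X/k,G}\subset\operatorname{Aut}_k(X)$ for the normalizer of $G$ in $\operatorname{Aut}_k(X)$, and $\mathcal A_{X/k,G}\subset\operatorname{Aut}(G)$ for the image of the homomorphism $\mathcal N_{X/k,G}\to\operatorname{Aut}(G)$ given by conjugation. A closed subset $Z\subset X$ is called distinguished if $\tau(Z)=Z$ for every $\tau\in\mathcal N_{X/k,G}$. A twisted $G$-quotient of $X$ over $k$ is an algebraic space $Y$ over $k$ with an isomorphism $Y_K\simeq X/G$ over $K$ such that for every $\sigma\in\operatorname{Gal}(K/k)$ there is a $\sigma$-linear automorphism of $X$ which commutes with the composition $X\to X/G\simeq Y_K\to Y$. A subset of $X/G\simeq Y_K$ descends to a closed subset of $Y$ if it is the inverse image of a closed subset of $Y$. (1) If $Z\subset X$ is a distinguished subset and $Y$ is a twisted $G$-quotient of $X$ over $k$, then $\pi(Z)\subset X/G$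 descends to a closed subset of $Y$. (2) Let $H\subset G$ be a subgroup and let $S_H$ be the set of subgroups of $G$ of the form $\phi(H)$ with $\phi\in\mathcal A_{X/k,G}$. For $H'\in S_H$ write $X^{H'}\subset X$ for the fixed locus of $H'$. Then $\bigcup_{H'\in S_H}X^{H'}$ and $\bigcap_{H'\in S_H}X^{H'}$ are distinguished subsets of $X$; consequently, for every twisted $G$-quotient $Y$ of $X$ over $k$, their images in $X/G$ descend to closed subsets of $Y$. -/

import Mathlib

open CategoryTheory CategoryTheory.Limits AlgebraicGeometry Opposite

universe u

/-- Presheaves of sets on the category of schemes. -/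
abbrev SchPresheaf : Type (u + 1) := Scheme.{u}ᵒᵖ ⥤ Type u

/-- `Spec R`, viewed as a presheaf on schemes. -/
noncomputable abbrev specP (R : Type u) [CommRing R] : SchPresheaf.{u} :=
  yoneda.obj (Spec (CommRingCat.of R))

/-- The morphism `Spec S ⟶ Spec R` induced by a ring homomorphism `R →+* S`. -/
noncomputable abbrev specPMap {R S : Type u} [CommRing R] [CommRing S] (f : R →+* S) :
    specP S ⟶ specP R :=
  yoneda.map (Spec.map (CommRingCat.ofHom f))

/-! ### Algebraic spaces -/

/-- A morphism from a scheme to an algebraic space is étale if it is representable by étale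
morphisms of schemes. -/
abbrev IsEtaleMap {U : Scheme.{u}} {F : SchPresheaf.{u}} (f : yoneda.obj U ⟶ F) : Prop :=
  MorphismProperty.presheaf (@Etale) f

/-- An étale atlas: a morphism from a scheme representable by étale surjections. -/
abbrev IsEtaleAtlas {U : Scheme.{u}} {F : SchPresheaf.{u}} (f : yoneda.obj U ⟶ F) : Prop :=
  MorphismProperty.presheaf (@Etale) f ∧ MorphismProperty.presheaf (@Surjective) f

/-- Algebraic spaces: étale sheaves whose diagonal is representable (by schemes) and which
admit an étale surjection from a scheme. An algebraic space over a scheme `S` is an algebraic space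
`F` with a morphism `F ⟶ yoneda.obj S`. -/
structure IsAlgebraicSpace (F : SchPresheaf.{u}) : Prop where
  isSheaf : Presheaf.IsSheaf Scheme.etaleTopology.{u} F
  diagonal : yoneda.relativelyRepresentable (Limits.diag F)
  exists_atlas : ∃ (U : Scheme.{u}) (f : yoneda.obj U ⟶ F), IsEtaleAtlas f

/-- A morphism is separated if its diagonal is a closed immersion. -/
def IsSeparatedOver {F S : SchPresheaf.{u}} (s : F ⟶ S) : Prop :=
  MorphismProperty.presheaf (@IsClosedImmersion) (pullback.diagonal s)

/-- `F` is of finite type over the scheme `S`: it has an étale atlas by a scheme `U` which is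
quasi-compact and locally of finite type over `S` (used for `S` affine). -/
def IsFiniteType {F : SchPresheaf.{u}} {S : Scheme.{u}} (s : F ⟶ yoneda.obj S) : Prop :=
  ∃ (U : Scheme.{u}) (f : yoneda.obj U ⟶ F) (g : U ⟶ S), IsEtaleAtlas f ∧
    f ≫ s = yoneda.map g ∧ LocallyOfFiniteType g ∧ QuasiCompact g

/-- `F` is normal: the local rings of every scheme étale over `F` are integrally closed domains. -/
def IsNormalSpace (F : SchPresheaf.{u}) : Prop :=
  ∀ (U : Scheme.{u}) (f : yoneda.obj U ⟶ F), IsEtaleMap f →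
    ∀ x : U, IsDomain (U.presheaf.stalk x) ∧ IsIntegrallyClosed (U.presheaf.stalk x)

/-! ### The underlying topological space -/

/-- A morphism `Spec L ⟶ F` with `L` a field. -/
structure FieldPoint (F : SchPresheaf.{u}) where
  field : Type u
  [inst : Field field]
  pt : specP field ⟶ F

attribute [instance] FieldPoint.inst

/-- Two field-valued points are equivalent if they agree over a common field extension. -/
def FieldPoint.Equivalent {F : SchPresheaf.{u}} (x y : FieldPoint F) : Prop :=
  ∃ (M : Type u) (_ : Field M) (i : x.field →+* M) (j : y.field →+* M),
    specPMap i ≫ x.pt = specPMap j ≫ y.pt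

theorem specPMap_comp {R S T : Type u} [CommRing R] [CommRing S] [CommRing T]
    (f : R →+* S) (g : S →+* T) : specPMap (g.comp f) = specPMap g ≫ specPMap f := by
  rw [← Functor.map_comp, ← Spec.map_comp, ← CommRingCat.ofHom_comp]

theorem FieldPoint.equivalent_equivalence (F : SchPresheaf.{u}) :
    Equivalence (FieldPoint.Equivalent (F := F)) where
  refl x := ⟨x.field, x.inst, RingHom.id _, RingHom.id _, rfl⟩
  symm := fun ⟨M, hM, i, j, h⟩ => ⟨M, hM, j, i, h.symm⟩
  trans := by
    rintro x y z ⟨M, _, i, j, h⟩ ⟨N, _, i', j', h'⟩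
    let := j.toAlgebra
    let := i'.toAlgebra
    obtain ⟨m, hm⟩ := Ideal.exists_maximal (TensorProduct y.field M N)
    let : Field (TensorProduct y.field M N ⧸ m) := Ideal.Quotient.field m
    let a : M →+* (TensorProduct y.field M N ⧸ m) :=
      (Ideal.Quotient.mk m).comp
        (Algebra.TensorProduct.includeLeft : M →ₐ[y.field] TensorProduct y.field M N).toRingHom
    let b : N →+* (TensorProduct y.field M N ⧸ m) :=
      (Ideal.Quotient.mk m).comp
        (Algebra.TensorProduct.includeRight : N →ₐ[y.field] TensorProduct y.field M N).toRingHom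
    have hab : a.comp j = b.comp i' := by
      ext t
      have h1 := (Algebra.TensorProduct.includeLeft :
        M →ₐ[y.field] TensorProduct y.field M N).commutes t
      have h2 := (Algebra.TensorProduct.includeRight :
        N →ₐ[y.field] TensorProduct y.field M N).commutes t
      exact congrArg (Ideal.Quotient.mk m) (h1.trans h2.symm)
    refine ⟨_, inferInstance, a.comp i, b.comp j', ?_⟩
    calc specPMap (a.comp i) ≫ x.pt = specPMap a ≫ specPMap i ≫ x.pt := by
          rw [specPMap_comp i a, Category.assoc]
      _ = specPMap (a.comp j) ≫ y.pt := by rw [h, specPMap_comp j a, Category.assoc]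
      _ = specPMap b ≫ specPMap i' ≫ y.pt := by rw [hab, specPMap_comp i' b, Category.assoc]
      _ = specPMap (b.comp j') ≫ z.pt := by rw [h', specPMap_comp j' b, Category.assoc]

instance FieldPoint.setoid (F : SchPresheaf.{u}) : Setoid (FieldPoint F) :=
  ⟨FieldPoint.Equivalent, FieldPoint.equivalent_equivalence F⟩

/-- The underlying set `|F|` of an algebraic space: field-valued points up to equivalence. -/
def Points (F : SchPresheaf.{u}) : Type (u + 1) := Quotient (FieldPoint.setoid F)

/-- The map `|F| → |F'|` induced by a morphism `F ⟶ F'`. -/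
noncomputable def Points.map {F F' : SchPresheaf.{u}} (f : F ⟶ F') : Points F → Points F' :=
  Quotient.map (fun x => { field := x.field, pt := x.pt ≫ f }) (by
    rintro x y ⟨M, hM, i, j, h⟩
    exact ⟨M, hM, i, j, by simp only [← Category.assoc, h]⟩)

/-- The map `U → |F|` induced by a morphism from a scheme `U` to `F`; it sends `x` to the class of
`Spec κ(x) ⟶ U ⟶ F`. -/
noncomputable def Points.ofScheme {U : Scheme.{u}} {F : SchPresheaf.{u}} (f : yoneda.obj U ⟶ F)
    (x : U) : Points F :=
  Quotient.mk _
    { field := U.residueField x, pt := yoneda.map (U.fromSpecResidueField x) ≫ f }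

/-- The Zariski topology on `|F|`: a subset is open iff its preimage in every scheme étale over `F`
is open. -/
instance (F : SchPresheaf.{u}) : TopologicalSpace (Points F) where
  IsOpen V := ∀ (U : Scheme.{u}) (f : yoneda.obj U ⟶ F), IsEtaleMap f →
    IsOpen (Points.ofScheme f ⁻¹' V)
  isOpen_univ _ _ _ := isOpen_univ
  isOpen_inter _ _ hV hW U f hf := (hV U f hf).inter (hW U f hf)
  isOpen_sUnion S hS U f hf := by
    rw [Set.preimage_sUnion]
    exact isOpen_biUnion fun V hV => hS V hV U f hf

/-! ### Automorphisms and quotients -/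

/-- The group of automorphisms of `F` over `S`, as a subgroup of the group of all
automorphisms of `F`. -/
def autOver {F S : SchPresheaf.{u}} (s : F ⟶ S) : Subgroup (Aut F) where
  carrier := {φ | φ.hom ≫ s = s}
  one_mem' := Category.id_comp s
  mul_mem' {φ ψ} hφ hψ := by
    change (ψ.hom ≫ φ.hom) ≫ s = s
    rw [Category.assoc, show φ.hom ≫ s = s from hφ, show ψ.hom ≫ s = s from hψ]
  inv_mem' {φ} hφ := by
    exact (Iso.inv_comp_eq (φ : F ≅ F)).2 (show φ.hom ≫ s = s from hφ).symm

/-- `π : X ⟶ Q` is the quotient `X ⟶ X/G` of `X` by the finite group `G` of automorphisms: it is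
a `G`-invariant affine morphism of algebraic spaces with `𝒪_Q = (π_* 𝒪_X)^G` on the étale site
of `Q`. The last condition says that for every scheme `U` étale over `Q`, with `T = X ×_Q U`, the
map `Γ(U) → Γ(T)` is injective, with image the functions on `T` fixed by the automorphisms
`γ` of `T` over `U` induced by the elements of `G`. -/
structure IsQuotientBy {X Q : SchPresheaf.{u}} (G : Subgroup (Aut X)) (π : X ⟶ Q) : Prop where
  isAlgebraicSpace : IsAlgebraicSpace Q
  invariant : ∀ g ∈ G, g.hom ≫ π = π
  affine : MorphismProperty.presheaf (@IsAffineHom) π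
  injective : ∀ (T U : Scheme.{u}) (p : yoneda.obj T ⟶ X) (v : T ⟶ U) (f : yoneda.obj U ⟶ Q),
    IsEtaleMap f → IsPullback p (yoneda.map v) π f → Function.Injective v.appTop
  mem_range_iff : ∀ (T U : Scheme.{u}) (p : yoneda.obj T ⟶ X) (v : T ⟶ U)
    (f : yoneda.obj U ⟶ Q), IsEtaleMap f → IsPullback p (yoneda.map v) π f →
    ∀ t : Γ(T, ⊤), t ∈ Set.range v.appTop ↔
      ∀ g ∈ G, ∀ γ : T ⟶ T, γ ≫ v = v → yoneda.map γ ≫ p = p ≫ g.hom → γ.appTop t = t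

section Twisted

variable (k : Type u) {K : Type u} [Field k] [Field K] [Algebra k K] {X Q : SchPresheaf.{u}}

/-- The structure morphism to `Spec k` of a space over the extension `K` of `k`. -/
noncomputable abbrev toBase (sX : X ⟶ specP K) : X ⟶ specP k :=
  sX ≫ specPMap (algebraMap k K)

/-- Twisted `G`-quotients over `k` of the space `X` over `K`, where `π : X ⟶ Q` is the projection to
`Q = X/G` and `sX`, `sQ` are the structure morphisms: algebraic spaces `Y` over `k` with an
identification of `X/G` with `Y_K` (given by the cartesian square
with sides `X/G ⟶ Y` and `X/G ⟶ Spec K`), such that for every `σ` in `Gal(K/k)` there is a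
`σ`-linear automorphism `φ` of `X` commuting with the composition `X ⟶ X/G ⟶ Y`. -/
structure TwistedQuotient (sX : X ⟶ specP K) (π : X ⟶ Q) (sQ : Q ⟶ specP K) where
  Y : SchPresheaf.{u}
  isAlgebraicSpace : IsAlgebraicSpace Y
  sY : Y ⟶ specP k
  fromQuotient : Q ⟶ Y
  isPullback : IsPullback fromQuotient sQ sY (specPMap (algebraMap k K))
  exists_semilinear : ∀ σ : K ≃ₐ[k] K, ∃ φ : Aut X,
    φ.hom ≫ sX = sX ≫ specPMap (σ : K →+* K) ∧
      φ.hom ≫ π ≫ fromQuotient = π ≫ fromQuotient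

/-- A subset `C` of `|X/G| = |Y_K|` descends to a closed subset of the twisted quotient `Y`: it is
the preimage of a closed subset of `|Y|`. -/
def TwistedQuotient.Descends {sX : X ⟶ specP K} {π : X ⟶ Q} {sQ : Q ⟶ specP K}
    (Y : TwistedQuotient k sX π sQ) (C : Set (Points Q)) : Prop :=
  ∃ W : Set (Points Y.Y), IsClosed W ∧ Points.map Y.fromQuotient ⁻¹' W = C

/-- The normalizer `𝒩_{X/k,G}` of `G` in `Aut_k(X)`. -/
noncomputable def normalizerOver (sX : X ⟶ specP K) (G : Subgroup (Aut X)) : Subgroup (Aut X) :=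
  Subgroup.normalizer (G : Set (Aut X)) ⊓ autOver (toBase k sX)

/-- Distinguished subsets: closed subsets `Z` of `|X|` with `τ(Z) = Z` for all `τ` in the
normalizer of `G` in `Aut_k(X)`. -/
def IsDistinguished (sX : X ⟶ specP K) (G : Subgroup (Aut X)) (Z : Set (Points X)) : Prop :=
  IsClosed Z ∧ ∀ τ ∈ normalizerOver k sX G, Points.map τ.hom '' Z = Z

/-- `𝒜_{X/k,G}`: the image of the conjugation homomorphism from the normalizer of `G` in
`Aut_k(X)` to `Aut(G)`. -/
noncomputable def conjAut (sX : X ⟶ specP K) (G : Subgroup (Aut X)) : Subgroup (MulAut G) :=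
  ((normalizerOver k sX G).subgroupOf (Subgroup.normalizer (G : Set (Aut X)))).map
    G.normalizerMonoidHom

/-- The orbit `S_H` of a subgroup `H` of `G` under `𝒜_{X/k,G}`. -/
def subgroupOrbit (sX : X ⟶ specP K) (G : Subgroup (Aut X)) (H : Subgroup G) :
    Set (Subgroup G) :=
  {H' | ∃ φ ∈ conjAut k sX G, H' = H.map φ.toMonoidHom}

/-- The (closed) set of points of `|X|` underlying the fixed locus `X^H`, the subfunctor of
`H`-invariant points of `X`: the classes of the field-valued points fixed by `H`. -/
def fixedLocus {G : Subgroup (Aut X)} (H : Subgroup G) : Set (Points X) :=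
  {x | ∃ p : FieldPoint X, (∀ h ∈ H, p.pt ≫ (h : Aut X).hom = p.pt) ∧
    (Quotient.mk _ p : Points X) = x}

end Twisted

/-!
The heart of the matter is that a `σ`-linear automorphism `φ` of `X` over a twisted quotient `Y`
normalizes `G` (`TwistedQuotient.mem_normalizerOver`), so that it preserves distinguished subsets.
A conjugate of an element of `G` by `φ` is a `K`-automorphism of `X` over `Y`, hence over
`X/G = Y_K`, and it suffices that every automorphism `h` of `X` over `X/G` lies in `G`
(`IsQuotientBy.mem_of_hom_comp_eq`). Two homomorphisms from a ring `B` to a domain that agree on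
`B^G` differ by an element of `G` (`exists_eq_comp_of_eq_on_invariants`), so on a small integral
étale chart of `X` the automorphism `h` agrees with some `g` in `G`. The set of points of `X` around
which `h` and `g` agree étale locally is open; it is closed because `X` is separated and, being
normal and locally Noetherian, étale locally integral. Hence it is all of the connected space `X`,
and `h = g` because `X` is an étale sheaf.

Given a distinguished `Z`, its image in `X/G` is closed since `X ⟶ X/G` is integral on étale charts
(`IsQuotientBy.isClosed_image`), and the image of that in `Y` is closed since `K/k` is algebraic.
Two points of `X/G` with the same image in `Y` have representatives over a common field whose
`K`-structures differ by an element of `Gal(K/k)`, because `K/k` is normal; a semilinear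
automorphism of `X` therefore moves a point of `Z` over the one to a point of `Z` over the other, so
the image of `Z` is the full preimage of its image in `Y` (`TwistedQuotient.descends_image`).

For the fixed loci, an element `τ` of the normalizer maps `X^H` to `X^{τHτ⁻¹}`, so it permutes the
loci attached to an orbit; each of them is closed since `X` is separated (`isClosed_fixedLocus`).
-/

/-! ### Points of a presheaf on schemes -/

namespace Points

/-- The point of `F` given by a field-valued point. -/
def mk {F : SchPresheaf.{u}} {L : Type u} [Field L] (a : specP L ⟶ F) : Points F :=
  Quotient.mk (FieldPoint.setoid F) { field := L, pt := a }

theorem exists_rep {F : SchPresheaf.{u}} (x : Points F) :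
    ∃ (L : Type u) (_ : Field L) (a : specP L ⟶ F), x = mk a := by
  obtain ⟨⟨L, a⟩, rfl⟩ := Quotient.exists_rep x
  exact ⟨L, _, a, rfl⟩

/-- A field-valued point and its restriction to a larger field define the same point. -/
theorem mk_eq_mk_comp {F : SchPresheaf.{u}} {L M : Type u} [Field L] [Field M] (i : L →+* M)
    (a : specP L ⟶ F) :
    mk a = mk (specPMap i ≫ a) :=
  Quotient.sound ⟨M, inferInstance, i, RingHom.id M, by simp [specPMap]⟩

theorem ofScheme_eq_mk {U : Scheme.{u}} {F : SchPresheaf.{u}} (f : yoneda.obj U ⟶ F) (x : U) :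
    ofScheme f x = mk (L := U.residueField x) (yoneda.map (U.fromSpecResidueField x) ≫ f) := rfl

theorem mk_comp_eq_ofScheme {U : Scheme.{u}} {F : SchPresheaf.{u}} (f : yoneda.obj U ⟶ F)
    {L : Type u} [Field L] (a : Spec (CommRingCat.of L) ⟶ U) :
    ∃ x : U, mk (yoneda.map a ≫ f) = ofScheme f x := by
  obtain ⟨⟨x, i⟩, rfl⟩ := (Scheme.SpecToEquivOfField L U).symm.surjective a
  refine ⟨x, ?_⟩
  rw [ofScheme_eq_mk, mk_eq_mk_comp i.hom]
  simp [Scheme.SpecToEquivOfField]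
  rfl

theorem map_mk {F F' : SchPresheaf.{u}} (f : F ⟶ F') {L : Type u} [Field L] (a : specP L ⟶ F) :
    map f (mk a) = mk (a ≫ f) := rfl

theorem map_ofScheme {U : Scheme.{u}} {F F' : SchPresheaf.{u}} (f : yoneda.obj U ⟶ F)
    (g : F ⟶ F') (x : U) : map g (ofScheme f x) = ofScheme (f ≫ g) x := by
  rw [ofScheme_eq_mk, map_mk, Category.assoc, ofScheme_eq_mk]

theorem map_map {F F' F'' : SchPresheaf.{u}} (f : F ⟶ F') (g : F' ⟶ F'') (x : Points F) :
    map g (map f x) = map (f ≫ g) x := by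
  obtain ⟨L, _, a, rfl⟩ := exists_rep x
  simp only [map_mk, Category.assoc]

theorem map_id {F : SchPresheaf.{u}} (x : Points F) : map (𝟙 F) x = x := by
  obtain ⟨L, _, a, rfl⟩ := exists_rep x
  simp only [map_mk, Category.comp_id]

theorem ofScheme_map {U V : Scheme.{u}} {F : SchPresheaf.{u}} (w : V ⟶ U)
    (f : yoneda.obj U ⟶ F) (x : V) :
    ofScheme (yoneda.map w ≫ f) x = ofScheme f (w x) := by
  rw [ofScheme_eq_mk, ofScheme_eq_mk, mk_eq_mk_comp (w.residueFieldMap x).hom]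
  congr 1
  rw [specPMap, ← Category.assoc, ← Category.assoc, ← Functor.map_comp, ← Functor.map_comp,
    CommRingCat.ofHom_hom, Scheme.Hom.SpecMap_residueFieldMap_fromSpecResidueField]

/-- Two points of `F` and `G` with the same image in `H` have representatives over a common
field that agree in `H`. -/
theorem exists_common_rep {F G H : SchPresheaf.{u}} (f : F ⟶ H) (g : G ⟶ H) {L L' : Type u}
    [Field L] [Field L'] (a : specP L ⟶ F) (b : specP L' ⟶ G)
    (h : map f (mk a) = map g (mk b)) :
    ∃ (M : Type u) (_ : Field M) (i : L →+* M) (j : L' →+* M),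
      (specPMap i ≫ a) ≫ f = (specPMap j ≫ b) ≫ g := by
  obtain ⟨M, hM, i, j, h⟩ := Quotient.exact h
  exact ⟨M, hM, i, j, by simpa using h⟩

/-- The points of a fibre product surject onto the fibre product of the sets of points. -/
theorem exists_of_isPullback {P F G H : SchPresheaf.{u}} {p : P ⟶ F} {q : P ⟶ G} {f : F ⟶ H}
    {g : G ⟶ H} (hP : IsPullback p q f g) (x : Points F) (y : Points G)
    (h : map f x = map g y) : ∃ z : Points P, map p z = x ∧ map q z = y := by
  obtain ⟨L, _, a, rfl⟩ := exists_rep x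
  obtain ⟨L', _, b, rfl⟩ := exists_rep y
  obtain ⟨M, hM, i, j, h⟩ := exists_common_rep f g a b h
  refine ⟨mk (hP.lift _ _ h), ?_, ?_⟩
  · rw [map_mk, hP.lift_fst, ← mk_eq_mk_comp]
  · rw [map_mk, hP.lift_snd, ← mk_eq_mk_comp]

theorem ofScheme_id_injective (U : Scheme.{u}) :
    Function.Injective (ofScheme (𝟙 (yoneda.obj U))) := by
  intro x y h
  obtain ⟨M, hM, i, j, h⟩ := Quotient.exact h
  have h' : Spec.map (CommRingCat.ofHom i) ≫ U.fromSpecResidueField x =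
      Spec.map (CommRingCat.ofHom j) ≫ U.fromSpecResidueField y :=
    yoneda.map_injective (by simpa using h)
  have := congrArg (fun t => t.base (default : Spec (CommRingCat.of M))) h'
  exact (Scheme.fromSpecResidueField_apply x _).symm.trans
    (this.trans (Scheme.fromSpecResidueField_apply y _))

theorem ofScheme_id_surjective (U : Scheme.{u}) :
    Function.Surjective (ofScheme (𝟙 (yoneda.obj U))) := by
  intro x
  obtain ⟨L, _, a, rfl⟩ := exists_rep x
  obtain ⟨a, rfl⟩ := yoneda.map_surjective a
  obtain ⟨x, h⟩ := mk_comp_eq_ofScheme (𝟙 (yoneda.obj U)) a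
  exact ⟨x, by rw [← h, Category.comp_id]⟩

theorem ofScheme_eq_map {U : Scheme.{u}} {F : SchPresheaf.{u}} (f : yoneda.obj U ⟶ F) (x : U) :
    ofScheme f x = map f (ofScheme (𝟙 _) x) := by
  rw [map_ofScheme, Category.id_comp]

/-- The points of a fibre product `T = X ×_Q U` surject onto pairs of points with the same image
in `Q`. -/
theorem exists_ofScheme_of_isPullback {T U : Scheme.{u}} {X Q : SchPresheaf.{u}}
    {p : yoneda.obj T ⟶ X} {v : T ⟶ U} {π : X ⟶ Q} {f : yoneda.obj U ⟶ Q}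
    (hT : IsPullback p (yoneda.map v) π f) (x : Points X) (u : U)
    (h : map π x = ofScheme f u) : ∃ t : T, ofScheme p t = x ∧ v t = u := by
  obtain ⟨z, hz, hz'⟩ := exists_of_isPullback hT x (ofScheme (𝟙 _) u)
    (by rw [h, ofScheme_eq_map])
  obtain ⟨t, rfl⟩ := ofScheme_id_surjective T z
  refine ⟨t, by rw [← hz, ofScheme_eq_map], ofScheme_id_injective U ?_⟩
  rw [← hz', map_ofScheme, ← ofScheme_map, Category.id_comp, Category.comp_id]

/-- The preimage in `U` of the image of `Z` is the image of the preimage of `Z` in `T = X ×_Q U`. -/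
theorem ofScheme_preimage_image_map {T U : Scheme.{u}} {X Q : SchPresheaf.{u}}
    {p : yoneda.obj T ⟶ X} {v : T ⟶ U} {π : X ⟶ Q} {f : yoneda.obj U ⟶ Q}
    (hT : IsPullback p (yoneda.map v) π f) (Z : Set (Points X)) :
    ofScheme f ⁻¹' (map π '' Z) = v '' (ofScheme p ⁻¹' Z) := by
  ext u
  constructor
  · rintro ⟨x, hx, h⟩
    obtain ⟨t, rfl, rfl⟩ := exists_ofScheme_of_isPullback hT x u h
    exact ⟨t, hx, rfl⟩
  · rintro ⟨t, ht, rfl⟩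
    exact ⟨_, ht, by rw [map_ofScheme, hT.w, ofScheme_map]⟩

theorem exists_of_ofScheme_eq {R U V : Scheme.{u}} {F : SchPresheaf.{u}}
    {r : R ⟶ U} {s : R ⟶ V} {f : yoneda.obj U ⟶ F} {g : yoneda.obj V ⟶ F}
    (hR : IsPullback (yoneda.map r) (yoneda.map s) f g) {x : U} {y : V}
    (h : ofScheme f x = ofScheme g y) : ∃ z : R, r z = x ∧ s z = y := by
  obtain ⟨z, hz, hz'⟩ := exists_ofScheme_of_isPullback hR (ofScheme (𝟙 _) x) y
    (by rw [← ofScheme_eq_map, h])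
  refine ⟨z, ofScheme_id_injective U ?_, hz'⟩
  rw [← hz, ← ofScheme_map, Category.comp_id]

end Points

/-! ### Étale maps and atlases -/

theorem IsEtaleMap.comp {U V : Scheme.{u}} {F : SchPresheaf.{u}} (w : V ⟶ U) [Etale w]
    {f : yoneda.obj U ⟶ F} (hf : IsEtaleMap f) : IsEtaleMap (yoneda.map w ≫ f) :=
  have : MorphismProperty.IsStableUnderComposition @Etale.{u} :=
    MorphismProperty.IsMultiplicative.toIsStableUnderComposition
  (MorphismProperty.relative_isStableUnderComposition (F := yoneda) (P := @Etale)).comp_mem _ _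
    (MorphismProperty.relative_map (P := @Etale) ‹Etale w›) hf

theorem IsEtaleMap.of_isPullback {T U : Scheme.{u}} {X Q : SchPresheaf.{u}}
    {p : yoneda.obj T ⟶ X} {v : T ⟶ U} {π : X ⟶ Q} {f : yoneda.obj U ⟶ Q}
    (hf : IsEtaleMap f) (hT : IsPullback p (yoneda.map v) π f) : IsEtaleMap p :=
  (MorphismProperty.relative_isStableUnderBaseChange (F := yoneda) @Etale).of_isPullback
    hT.flip hf

theorem IsEtaleMap.exists_pullback {U V : Scheme.{u}} {F : SchPresheaf.{u}}
    {f : yoneda.obj U ⟶ F} (hf : IsEtaleMap f) (g : yoneda.obj V ⟶ F) :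
    ∃ (R : Scheme.{u}) (r : R ⟶ U) (s : R ⟶ V),
      IsPullback (yoneda.map r) (yoneda.map s) f g ∧ Etale s :=
  ⟨_, _, _, hf.rep.isPullback' g, hf.property_snd g⟩

/-- Étale maps are open on points, since étale morphisms of schemes are. -/
theorem IsEtaleMap.isOpen_range {U : Scheme.{u}} {F : SchPresheaf.{u}} {f : yoneda.obj U ⟶ F}
    (hf : IsEtaleMap f) : IsOpen (Set.range (Points.ofScheme f)) := by
  intro V g hg
  obtain ⟨R, r, s, hR, hs⟩ := hf.exists_pullback g
  convert (s.isOpenMap).isOpen_range using 1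
  ext y
  constructor
  · rintro ⟨x, hx⟩
    obtain ⟨z, -, rfl⟩ := Points.exists_of_ofScheme_eq hR hx
    exact ⟨z, rfl⟩
  · rintro ⟨z, rfl⟩
    exact ⟨r z, by rw [← Points.ofScheme_map, ← Points.ofScheme_map, hR.w]⟩

theorem IsEtaleAtlas.isEtaleMap {U : Scheme.{u}} {F : SchPresheaf.{u}} {f : yoneda.obj U ⟶ F}
    (hf : IsEtaleAtlas f) : IsEtaleMap f := hf.1

theorem IsEtaleAtlas.surjective {U : Scheme.{u}} {F : SchPresheaf.{u}} {f : yoneda.obj U ⟶ F}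
    (hf : IsEtaleAtlas f) : Function.Surjective (Points.ofScheme f) := by
  intro x
  obtain ⟨L, _, a, rfl⟩ := Points.exists_rep x
  have hsurj : Surjective (hf.2.rep.snd a) := hf.2.property_snd a
  obtain ⟨z, -⟩ := hsurj.surj (default : Spec (CommRingCat.of L))
  obtain ⟨y, h⟩ := Points.mk_comp_eq_ofScheme a (𝟙 (Spec (CommRingCat.of L)))
  refine ⟨hf.2.rep.fst' a z, ?_⟩
  have hw := (hf.2.rep.isPullback' a).w
  rw [← Points.ofScheme_map, hw, Points.ofScheme_map]
  have h2 : Points.mk a = Points.ofScheme a y := by rw [← h]; simp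
  rw [h2, Subsingleton.elim (hf.2.rep.snd a z) y]

/-! ### Equalizers of morphisms to a separated space -/

/-- A morphism from a reduced scheme factors through a closed subscheme as soon as it does so on
points. -/
theorem AlgebraicGeometry.IsClosedImmersion.exists_lift_of_isReduced {E U V : Scheme.{u}}
    (e : E ⟶ U) [IsClosedImmersion e] (t : V ⟶ U) [IsReduced V]
    (h : Set.range t ⊆ Set.range e) : ∃ l : V ⟶ E, l ≫ e = t := by
  have : Surjective (pullback.snd e t) := by
    rw [surjective_iff, ← Set.range_eq_univ, Scheme.Pullback.range_snd, Set.eq_univ_iff_forall]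
    exact fun v => h ⟨v, rfl⟩
  have := isIso_of_isClosedImmersion_of_surjective (pullback.snd e t)
  exact ⟨inv (pullback.snd e t) ≫ pullback.fst e t, by
    rw [Category.assoc, pullback.condition, IsIso.inv_hom_id_assoc]⟩

/-- Two morphisms over `S` from a scheme `U` to a separated space over `S` agree exactly on a closed
subscheme `E` of `U`. -/
theorem IsSeparatedOver.exists_equalizer {X S : SchPresheaf.{u}} {s : X ⟶ S}
    (hs : IsSeparatedOver s) {U : Scheme.{u}} (a b : yoneda.obj U ⟶ X) (hab : a ≫ s = b ≫ s) :
    ∃ (E : Scheme.{u}) (e : E ⟶ U), IsClosedImmersion e ∧ ∀ (V : Scheme.{u}) (t : V ⟶ U),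
      yoneda.map t ≫ a = yoneda.map t ≫ b ↔ ∃ l, l ≫ e = t := by
  obtain ⟨c, hca, hcb⟩ : ∃ c : yoneda.obj U ⟶ pullback.diagonalObj s,
      c ≫ pullback.fst s s = a ∧ c ≫ pullback.snd s s = b :=
    ⟨pullback.lift a b hab, pullback.lift_fst _ _ _, pullback.lift_snd _ _ _⟩
  have hsq := hs.rep.isPullback c
  refine ⟨_, hs.rep.snd c, hs.property_snd _, fun V t => ?_⟩
  have h1 : hs.rep.fst c = yoneda.map (hs.rep.snd c) ≫ a := by
    simpa [hca] using congrArg (· ≫ pullback.fst s s) hsq.w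
  have h2 : hs.rep.fst c = yoneda.map (hs.rep.snd c) ≫ b := by
    simpa [hcb] using congrArg (· ≫ pullback.snd s s) hsq.w
  constructor
  · intro h
    refine ⟨hs.rep.lift (yoneda.map t ≫ a) t ?_, hs.rep.lift_snd _ _ _⟩
    apply pullback.hom_ext
    · simp [hca]
    · simp [hcb, h]
  · rintro ⟨l, rfl⟩
    rw [Functor.map_comp, Category.assoc, Category.assoc, ← h1, ← h2]

/-- Two morphisms from a reduced scheme to a separated space are equal if they agree after
composition with a morphism of dense image. -/
theorem IsSeparatedOver.eq_of_dense {X S : SchPresheaf.{u}} {s : X ⟶ S}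
    (hs : IsSeparatedOver s) {U R : Scheme.{u}} [IsReduced U] {a b : yoneda.obj U ⟶ X}
    (hab : a ≫ s = b ≫ s) (r : R ⟶ U) (hr : DenseRange r)
    (h : yoneda.map r ≫ a = yoneda.map r ≫ b) : a = b := by
  obtain ⟨E, e, he, H⟩ := hs.exists_equalizer a b hab
  obtain ⟨l, rfl⟩ := (H R r).1 h
  have hdense : DenseRange e := hr.mono (by rintro _ ⟨x, rfl⟩; exact ⟨l x, rfl⟩)
  have hrange : Set.range e = Set.univ := by
    rw [← e.isClosedEmbedding.isClosed_range.closure_eq]; exact hdense.closure_range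
  obtain ⟨m, hm⟩ := IsClosedImmersion.exists_lift_of_isReduced e (𝟙 U) (by simp [hrange])
  simpa using (H U (𝟙 U)).2 ⟨m, hm⟩

/-- Two sections of an étale sheaf that agree on a jointly surjective family of étale morphisms are
equal. -/
theorem IsAlgebraicSpace.hom_ext_of_etale {X : SchPresheaf.{u}} (hX : IsAlgebraicSpace X)
    {V : Scheme.{u}} {a b : yoneda.obj V ⟶ X}
    (h : ∀ v : V, ∃ (R : Scheme.{u}) (r : R ⟶ V), Etale r ∧ v ∈ Set.range r ∧
      yoneda.map r ≫ a = yoneda.map r ≫ b) : a = b := by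
  choose R r hr hv hab using h
  have hcov : Sieve.ofArrows R r ∈ Scheme.etaleTopology V :=
    Precoverage.generate_mem_toGrothendieck
      ((Scheme.ofArrows_mem_precoverage_iff (P := @Etale)).2 ⟨fun v => ⟨v, hv v⟩, hr⟩)
  have hsep := ((isSheaf_iff_isSheaf_of_type _ _).1 hX.isSheaf _ hcov).isSeparatedFor
  apply yonedaEquiv.injective
  refine hsep.ext ?_
  rintro Y _ ⟨W, g, _, ⟨v⟩, rfl⟩
  have := hab v
  rw [yonedaEquiv_naturality, yonedaEquiv_naturality, Functor.map_comp, Category.assoc,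
    Category.assoc, this]

/-! ### Fixed loci -/

/-- In an étale chart `f : U ⟶ X` the fixed locus of `H` is the intersection of the closed
subschemes where `f ≫ h` and `f` agree, for `h` in `H`. -/
theorem isClosed_fixedLocus {K : Type u} [Field K] {X : SchPresheaf.{u}} {sX : X ⟶ specP K}
    (hsep : IsSeparatedOver sX) {G : Subgroup (Aut X)} (hG : G ≤ autOver sX) (H : Subgroup G) :
    IsClosed (fixedLocus H) := by
  refine isOpen_compl_iff.1 fun U f hf => isOpen_compl_iff.2 ?_
  choose! E e he hE using fun h : G =>
    hsep.exists_equalizer (f ≫ (h : Aut X).hom) f (by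
      rw [Category.assoc, show (h : Aut X).hom ≫ sX = sX from hG h.2])
  have key : Points.ofScheme f ⁻¹' (fixedLocus H) = ⋂ h ∈ H, Set.range (e h) := by
    ext x
    simp only [Set.mem_preimage, Set.mem_iInter]
    constructor
    · rintro ⟨p, hp, hpx⟩ h hh
      obtain ⟨M, _, i, j, hij⟩ := Quotient.exact hpx
      dsimp only at j hij
      obtain ⟨l, hl⟩ := (hE h _ (Spec.map (CommRingCat.ofHom j) ≫ U.fromSpecResidueField x)).1 (by
        rw [Functor.map_comp, Category.assoc, Category.assoc, ← reassoc_of% hij, hp h hh, hij])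
      refine ⟨l (default : Spec (CommRingCat.of M)), ?_⟩
      rw [← Scheme.Hom.comp_apply, hl]
      exact Scheme.fromSpecResidueField_apply x _
    · intro hx
      refine ⟨_, fun h hh => ?_, rfl⟩
      have := he h
      obtain ⟨l, hl⟩ := IsClosedImmersion.exists_lift_of_isReduced (e h)
        (U.fromSpecResidueField x) (by
          rw [Scheme.range_fromSpecResidueField]; simpa using hx h hh)
      simpa using (hE h _ _).2 ⟨l, hl⟩
  change IsClosed (Points.ofScheme f ⁻¹' (fixedLocus H))
  rw [key]
  exact isClosed_biInter fun h _ => have := he h; (e h).isClosedEmbedding.isClosed_range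

section Distinguished

variable (k : Type u) {K : Type u} [Field k] [Field K] [Algebra k K] {X : SchPresheaf.{u}}
  {sX : X ⟶ specP K} {G : Subgroup (Aut X)}

/-- `τ` maps the fixed locus of `H` into that of `τ H τ⁻¹`. -/
theorem Points.map_hom_image_subset_fixedLocus (τ : Subgroup.normalizer (G : Set (Aut X)))
    (H : Subgroup G) :
    Points.map (τ : Aut X).hom '' fixedLocus H ⊆
      fixedLocus (H.map (G.normalizerMonoidHom τ).toMonoidHom) := by
  rintro _ ⟨_, ⟨p, hp, rfl⟩, rfl⟩
  refine ⟨_, ?_, rfl⟩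
  rintro _ ⟨h, hh, rfl⟩
  have h1 : ((G.normalizerMonoidHom τ h : G) : Aut X) = τ * h * (τ : Aut X)⁻¹ := rfl
  change (p.pt ≫ (τ : Aut X).hom) ≫ (G.normalizerMonoidHom τ h : Aut X).hom = _
  have h2 : (τ : Aut X).hom ≫ ((τ : Aut X) * h * (τ : Aut X)⁻¹).hom =
      (h : Aut X).hom ≫ (τ : Aut X).hom := by
    change ((τ : Aut X) * h * (τ : Aut X)⁻¹ * τ).hom = ((τ : Aut X) * h).hom
    rw [inv_mul_cancel_right]
  rw [h1, Category.assoc, h2, reassoc_of% (hp h hh)]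

/-- A set mapped into itself by the whole normalizer is preserved by it. -/
theorem IsDistinguished.of_image_subset {Z : Set (Points X)} (hZ : IsClosed Z)
    (h : ∀ τ ∈ normalizerOver k sX G, Points.map τ.hom '' Z ⊆ Z) : IsDistinguished k sX G Z := by
  refine ⟨hZ, fun τ hτ => (h τ hτ).antisymm fun z hz => ?_⟩
  refine ⟨Points.map (τ⁻¹ : Aut X).hom z, h _ (inv_mem hτ) ⟨z, hz, rfl⟩, ?_⟩
  have : (τ⁻¹ : Aut X).hom ≫ τ.hom = 𝟙 X := τ.inv_hom_id
  rw [Points.map_map, this, Points.map_id]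

theorem normalizerMonoidHom_mem_conjAut {τ : Aut X} (hτ : τ ∈ normalizerOver k sX G) :
    G.normalizerMonoidHom ⟨τ, hτ.1⟩ ∈ conjAut k sX G :=
  ⟨⟨τ, hτ.1⟩, hτ, rfl⟩

theorem map_mem_subgroupOrbit {H H' : Subgroup G} (hH' : H' ∈ subgroupOrbit k sX G H)
    {φ : MulAut G} (hφ : φ ∈ conjAut k sX G) :
    H'.map φ.toMonoidHom ∈ subgroupOrbit k sX G H := by
  obtain ⟨ψ, hψ, rfl⟩ := hH'
  exact ⟨φ * ψ, mul_mem hφ hψ, by rw [Subgroup.map_map]; rfl⟩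

theorem isDistinguished_iUnion_fixedLocus [Finite G] (hsep : IsSeparatedOver sX)
    (hG : G ≤ autOver sX) (H : Subgroup G) :
    IsDistinguished k sX G (⋃ H' ∈ subgroupOrbit k sX G H, fixedLocus H') := by
  refine .of_image_subset k
    ((Set.toFinite _).isClosed_biUnion fun H' _ => isClosed_fixedLocus hsep hG H') fun τ hτ => ?_
  rintro _ ⟨z, hz, rfl⟩
  simp only [Set.mem_iUnion] at hz ⊢
  obtain ⟨H', hH', hz⟩ := hz
  exact ⟨_, map_mem_subgroupOrbit k hH' (normalizerMonoidHom_mem_conjAut k hτ),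
    Points.map_hom_image_subset_fixedLocus ⟨τ, hτ.1⟩ H' ⟨z, hz, rfl⟩⟩

theorem isDistinguished_iInter_fixedLocus (hsep : IsSeparatedOver sX) (hG : G ≤ autOver sX)
    (H : Subgroup G) :
    IsDistinguished k sX G (⋂ H' ∈ subgroupOrbit k sX G H, fixedLocus H') := by
  refine .of_image_subset k
    (isClosed_biInter fun H' _ => isClosed_fixedLocus hsep hG H') fun τ hτ => ?_
  rintro _ ⟨z, hz, rfl⟩
  simp only [Set.mem_iInter] at hz ⊢
  intro H' hH'
  have hφ := normalizerMonoidHom_mem_conjAut k hτ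
  -- `H'` is the transform under `τ` of another member of the orbit
  have h1 := hz _ (map_mem_subgroupOrbit k hH' (inv_mem hφ))
  have h2 := Points.map_hom_image_subset_fixedLocus ⟨τ, hτ.1⟩ _ ⟨z, h1, rfl⟩
  rw [Subgroup.map_map] at h2
  convert h2
  refine (Subgroup.map_id H').symm.trans (congrArg (Subgroup.map · H') ?_)
  ext1 g
  exact (MulAut.apply_inv_self _ (G.normalizerMonoidHom ⟨τ, hτ.1⟩) g).symm

end Distinguished

/-! ### Invariants of a finite group acting on a ring -/

section Invariants

open Polynomial

/- The action is given by ring endomorphisms `ρ g` with `ρ (g * h) = ρ h ∘ ρ g`, the form in which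
it arises by pulling back functions along automorphisms. -/
variable {A B D G : Type*} [CommRing A] [CommRing B] [CommRing D] [Group G]
  {ρ : G → B →+* B}

theorem map_prod_X_sub_C_of_mul [Fintype G] (hρ : ∀ g h b, ρ (g * h) b = ρ h (ρ g b)) (b : B)
    (h : G) :
    (∏ g, (X - C (ρ g b))).map (ρ h) = ∏ g, (X - C (ρ g b)) := by
  simp only [Polynomial.map_prod, Polynomial.map_sub, map_X, map_C, ← hρ]
  exact Fintype.prod_equiv (Equiv.mulRight h) _ _ fun g => rfl

/-- Each `b` is a root of the monic polynomial `∏ g, (X - ρ g b)`, whose coefficients are invariant.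
-/
theorem RingHom.isIntegral_of_range_eq_invariants [_root_.Finite G] (h1 : ∀ b, ρ 1 b = b)
    (hρ : ∀ g h b, ρ (g * h) b = ρ h (ρ g b)) (φ : A →+* B)
    (hφ : ∀ b, (∀ g, ρ g b = b) → b ∈ φ.range) : φ.IsIntegral := by
  intro b
  cases nonempty_fintype G
  have hmonic : (∏ g, (X - C (ρ g b))).Monic := monic_prod_of_monic _ _ fun g _ => monic_X_sub_C _
  obtain ⟨q, hq, -, hqm⟩ := lifts_and_natDegree_eq_and_monic (f := φ)
    ((lifts_iff_coeff_lifts _).2 fun n => hφ _ fun h => by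
      rw [← coeff_map, map_prod_X_sub_C_of_mul hρ]) hmonic
  refine ⟨q, hqm, ?_⟩
  rw [← Polynomial.eval_map, hq, eval_prod, Finset.prod_eq_zero (Finset.mem_univ 1)]
  simp [h1]

/-- Two homomorphisms into a domain that agree on the invariants differ, at each element, by some
`ρ g`. -/
theorem exists_apply_eq_of_eq_on_invariants [IsDomain D] [Finite G] (h1 : ∀ b, ρ 1 b = b)
    (hρ : ∀ g h b, ρ (g * h) b = ρ h (ρ g b)) (f₁ f₂ : B →+* D)
    (hf : ∀ b, (∀ g, ρ g b = b) → f₁ b = f₂ b) (b : B) : ∃ g, f₂ b = f₁ (ρ g b) := by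
  cases nonempty_fintype G
  have hP : (∏ g, (X - C (ρ g b))).map f₁ = (∏ g, (X - C (ρ g b))).map f₂ := by
    ext n
    rw [coeff_map, coeff_map]
    exact hf _ fun h => by rw [← coeff_map, map_prod_X_sub_C_of_mul hρ]
  have h0 : ((∏ g, (X - C (ρ g b))).map f₁).eval (f₂ b) = 0 := by
    rw [hP, Polynomial.eval_map, eval₂_hom, eval_prod, Finset.prod_eq_zero (Finset.mem_univ 1),
      map_zero]
    simp [h1]
  simp only [Polynomial.map_prod, Polynomial.map_sub, map_X, map_C, eval_prod, eval_sub, eval_X,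
    eval_C, Finset.prod_eq_zero_iff, Finset.mem_univ, true_and, sub_eq_zero] at h0
  exact h0

/-- Two homomorphisms into a domain that agree on the invariants of a finite group differ by an
element of the group. If each `g` failed at some `b g`, the polynomial with coefficients `b g`
would contradict the elementwise statement for the polynomial rings. -/
theorem exists_eq_comp_of_eq_on_invariants [IsDomain D] [Finite G] (h1 : ∀ b, ρ 1 b = b)
    (hρ : ∀ g h b, ρ (g * h) b = ρ h (ρ g b)) (f₁ f₂ : B →+* D)
    (hf : ∀ b, (∀ g, ρ g b = b) → f₁ b = f₂ b) : ∃ g, ∀ b, f₂ b = f₁ (ρ g b) := by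
  cases nonempty_fintype G
  by_contra! hne
  choose b hb using hne
  let e := Fintype.equivFin G
  let β : B[X] := ∑ g, monomial (e g : ℕ) (b g)
  have hβ : ∀ g, β.coeff (e g) = b g := fun g => by
    simp only [β, Polynomial.finsetSum_coeff, coeff_monomial]
    rw [Finset.sum_eq_single g] <;> simp +contextual [Fin.val_inj]
  obtain ⟨g, hg⟩ := exists_apply_eq_of_eq_on_invariants (ρ := fun g => mapRingHom (ρ g))
    (fun p => by ext; simp [h1]) (fun g h p => by ext; simp [hρ])
    (mapRingHom f₁) (mapRingHom f₂) (fun p hp => by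
      ext n
      simp only [coe_mapRingHom, coeff_map]
      exact hf _ fun g => by
        simpa using congrArg (fun q => coeff q n) (hp g)) β
  refine hb g ?_
  simpa [hβ] using congrArg (fun q => coeff q (e g)) hg

end Invariants

/-! ### Images of closed sets -/

/-- A morphism whose base changes to étale charts are integral is closed on points. -/
theorem Points.isClosed_map_image {X Q : SchPresheaf.{u}} {π : X ⟶ Q}
    (hπ : yoneda.relativelyRepresentable π)
    (hint : ∀ ⦃T U : Scheme.{u}⦄ (p : yoneda.obj T ⟶ X) (v : T ⟶ U) (f : yoneda.obj U ⟶ Q),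
      IsEtaleMap f → IsPullback p (yoneda.map v) π f → IsIntegralHom v)
    {Z : Set (Points X)} (hZ : IsClosed Z) : IsClosed (Points.map π '' Z) := by
  refine isOpen_compl_iff.1 fun U f hf => isOpen_compl_iff.2 ?_
  have hT := hπ.isPullback f
  have := hint _ _ _ hf hT
  change IsClosed (Points.ofScheme f ⁻¹' (Points.map π '' Z))
  rw [Points.ofScheme_preimage_image_map hT]
  refine (hπ.snd f).isClosedMap _ (isOpen_compl_iff.1 ?_)
  exact hZ.isOpen_compl _ _ (hf.of_isPullback hT)

/-! ### The quotient by a finite group -/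

theorem AlgebraicGeometry.Scheme.Hom.comp_appTop_hom_apply {T U V : Scheme.{u}} (a : T ⟶ U)
    (b : U ⟶ V) (t : Γ(V, ⊤)) : (a ≫ b).appTop.hom t = a.appTop.hom (b.appTop.hom t) := by
  rw [Scheme.Hom.comp_appTop, CommRingCat.comp_apply]

/-- An endomorphism of `X` over `Q` induces one of `T = X ×_Q U` over `U`. -/
theorem CategoryTheory.IsPullback.exists_yoneda_lift {X Q : SchPresheaf.{u}} {π : X ⟶ Q}
    {T U : Scheme.{u}} {p : yoneda.obj T ⟶ X} {v : T ⟶ U} {f : yoneda.obj U ⟶ Q}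
    (hT : IsPullback p (yoneda.map v) π f) {h : X ⟶ X} (hh : h ≫ π = π) :
    ∃ γ : T ⟶ T, γ ≫ v = v ∧ yoneda.map γ ≫ p = p ≫ h := by
  have w : (p ≫ h) ≫ π = yoneda.map v ≫ f := by rw [Category.assoc, hh, hT.w]
  obtain ⟨γ, hγ⟩ := yoneda.map_surjective (hT.lift _ _ w)
  refine ⟨γ, yoneda.map_injective ?_, ?_⟩
  · rw [Functor.map_comp, hγ, hT.lift_snd]
  · rw [hγ, hT.lift_fst]

namespace IsQuotientBy

variable {X Q : SchPresheaf.{u}} {G : Subgroup (Aut X)} {π : X ⟶ Q} (hπ : IsQuotientBy G π)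
  {T U : Scheme.{u}} {p : yoneda.obj T ⟶ X} {v : T ⟶ U} {f : yoneda.obj U ⟶ Q}

include hπ

/-- The action of `G` on `T = X ×_Q U` over an étale `U ⟶ Q`, with invariant functions `Γ(U)`. -/
theorem exists_action (hf : IsEtaleMap f) (hT : IsPullback p (yoneda.map v) π f) :
    ∃ γ : G → (T ⟶ T), (∀ g, yoneda.map (γ g) ≫ p = p ≫ (g : Aut X).hom) ∧ (∀ g, γ g ≫ v = v) ∧
      γ 1 = 𝟙 T ∧ (∀ g h, γ (g * h) = γ h ≫ γ g) ∧
      ∀ t : Γ(T, ⊤), (∀ g, (γ g).appTop t = t) → t ∈ Set.range v.appTop := by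
  choose γ hγv hγp using fun g : G => hT.exists_yoneda_lift (hπ.invariant g g.2)
  have hext : ∀ {a b : T ⟶ T}, a ≫ v = b ≫ v → yoneda.map a ≫ p = yoneda.map b ≫ p → a = b :=
    fun h h' => yoneda.map_injective
      (hT.hom_ext h' (by rw [← Functor.map_comp, h, Functor.map_comp]))
  refine ⟨γ, hγp, hγv, hext ?_ ?_, fun g h => hext ?_ ?_, fun t ht => ?_⟩
  · rw [hγv, Category.id_comp]
  · refine (hγp 1).trans ?_
    rw [CategoryTheory.Functor.map_id, Category.id_comp]
    exact Category.comp_id p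
  · rw [hγv, Category.assoc, hγv, hγv]
  · rw [hγp, Functor.map_comp, Category.assoc, hγp, reassoc_of% (hγp h)]
    rfl
  · refine (hπ.mem_range_iff T U p v f hf hT t).2 fun g hg γ' hγ' hγ'' => ?_
    rw [hext (hγ'.trans (hγv ⟨g, hg⟩).symm) (hγ''.trans (hγp ⟨g, hg⟩).symm), ht]

/-- Functions on `T` are integral over the invariant ones, so `T ⟶ U` is integral. -/
theorem isIntegralHom [Finite G] (hf : IsEtaleMap f) (hT : IsPullback p (yoneda.map v) π f) :
    IsIntegralHom v := by
  have hv : IsAffineHom v := hπ.affine.property _ _ _ hT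
  refine IsIntegralHom.hasAffineProperty.of_iSup_eq_top _ (iSup_affineOpens_eq_top U) fun W => ?_
  have hW : IsAffine W.1 := W.2
  have hT' := ((isPullback_morphismRestrict v W.1).flip.map yoneda).paste_horiz hT
  obtain ⟨γ, -, -, h1, hmul, hrange⟩ := hπ.exists_action (hf.comp W.1.ι) hT'
  have : IsAffineHom (v ∣_ W.1) := hπ.affine.property _ _ _ hT'
  refine ⟨isAffine_of_isAffineHom (v ∣_ W.1), ?_⟩
  exact RingHom.isIntegral_of_range_eq_invariants (ρ := fun g => (γ g).appTop.hom)
    (fun b => by rw [h1]; simp) (fun g h b => by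
      rw [hmul]; exact Scheme.Hom.comp_appTop_hom_apply _ _ _) _ hrange

theorem isClosed_image [Finite G] {Z : Set (Points X)} (hZ : IsClosed Z) :
    IsClosed (Points.map π '' Z) :=
  Points.isClosed_map_image hπ.affine.rep (fun _ _ _ _ _ => hπ.isIntegralHom) hZ

/-- An endomorphism of `X` over `Q` agrees with an element of `G` after restriction to any integral
scheme `V` that maps to some `T = X ×_Q U` with `U` affine. -/
theorem exists_eq_of_isIntegral [Finite G] [IsAffine U] (hf : IsEtaleMap f)
    (hT : IsPullback p (yoneda.map v) π f) {h : X ⟶ X} (hh : h ≫ π = π) {V : Scheme.{u}}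
    [IsIntegral V] (a : V ⟶ T) :
    ∃ g : G, (yoneda.map a ≫ p) ≫ h = (yoneda.map a ≫ p) ≫ (g : Aut X).hom := by
  have hv : IsAffineHom v := hπ.affine.property _ _ _ hT
  have : IsAffine T := isAffine_of_isAffineHom v
  obtain ⟨γ, hγp, -, h1, hmul, hrange⟩ := hπ.exists_action hf hT
  obtain ⟨η, hηv, hηp⟩ := hT.exists_yoneda_lift hh
  obtain ⟨g, hg⟩ := exists_eq_comp_of_eq_on_invariants (ρ := fun g => (γ g).appTop.hom)
    (fun b => by rw [h1]; simp) (fun g h b => by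
      rw [hmul]; exact Scheme.Hom.comp_appTop_hom_apply _ _ _) a.appTop.hom (a ≫ η).appTop.hom
    (fun b hb => by
      obtain ⟨c, rfl⟩ := hrange b hb
      change a.appTop.hom (v.appTop.hom c) = (a ≫ η).appTop.hom (v.appTop.hom c)
      simp only [← Scheme.Hom.comp_appTop_hom_apply, Category.assoc, hηv])
  have hag : a ≫ η = a ≫ γ g := ext_of_isAffine (by
    ext b
    exact (hg b).trans (Scheme.Hom.comp_appTop_hom_apply _ _ _).symm)
  refine ⟨g, ?_⟩
  rw [Category.assoc, Category.assoc, ← hηp, ← hγp, ← Category.assoc, ← Category.assoc,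
    ← Functor.map_comp, ← Functor.map_comp, hag]

end IsQuotientBy

/-! ### Morphisms agreeing étale locally -/

/-- The set of points of `X` around which, étale locally, the morphisms `a` and `b` agree. -/
def agreeLocus {X X' : SchPresheaf.{u}} (a b : X ⟶ X') : Set (Points X) :=
  {x | ∃ (U : Scheme.{u}) (f : yoneda.obj U ⟶ X), IsEtaleMap f ∧ f ≫ a = f ≫ b ∧
    x ∈ Set.range (Points.ofScheme f)}

section AgreeLocus

variable {X X' S : SchPresheaf.{u}} {a b : X ⟶ X'}

theorem isOpen_agreeLocus : IsOpen (agreeLocus a b) := by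
  refine isOpen_iff_forall_mem_open.2 ?_
  rintro x ⟨U, f, hf, hab, hx⟩
  exact ⟨_, fun y hy => ⟨U, f, hf, hab, hy⟩, hf.isOpen_range, hx⟩

theorem eq_of_agreeLocus_eq_univ (hX' : IsAlgebraicSpace X') (h : agreeLocus a b = Set.univ) :
    a = b := by
  refine hom_ext_yoneda fun V g => hX'.hom_ext_of_etale fun v => ?_
  obtain ⟨U, f, hf, hab, u, hu⟩ := h.ge (Set.mem_univ (Points.ofScheme g v))
  obtain ⟨R, r, s, hR, hs⟩ := hf.exists_pullback g
  obtain ⟨z, -, hz⟩ := Points.exists_of_ofScheme_eq hR hu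
  refine ⟨R, s, hs, ⟨z, hz⟩, ?_⟩
  rw [← reassoc_of% hR.w, ← reassoc_of% hR.w, hab]

/-- On a space that is étale locally integral, the locus where two morphisms to a separated space
agree étale locally is closed: an integral étale chart that meets it is contained in it. -/
theorem isClosed_agreeLocus {s : X' ⟶ S} (hs : IsSeparatedOver s) (hab : a ≫ s = b ≫ s)
    (hX : ∀ x : Points X, ∃ (U : Scheme.{u}) (f : yoneda.obj U ⟶ X), IsEtaleMap f ∧
      IsIntegral U ∧ x ∈ Set.range (Points.ofScheme f)) : IsClosed (agreeLocus a b) := by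
  refine isOpen_compl_iff.1 (isOpen_iff_forall_mem_open.2 fun x hx => ?_)
  obtain ⟨U, f, hf, hU, hxU⟩ := hX x
  refine ⟨_, ?_, hf.isOpen_range, hxU⟩
  rintro _ ⟨u, rfl⟩ ⟨V, g, hg, hgab, v, hv⟩
  obtain ⟨R, r, t, hR, ht⟩ := hg.exists_pullback f
  obtain ⟨z, -, -⟩ := Points.exists_of_ofScheme_eq hR hv
  refine hx ⟨U, f, hf, ?_, hxU⟩
  have hdense : DenseRange t := t.isOpenMap.isOpen_range.dense ⟨_, z, rfl⟩
  refine hs.eq_of_dense (by simp [hab]) t hdense ?_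
  rw [← reassoc_of% hR.w, ← reassoc_of% hR.w, hgab]

end AgreeLocus

/-! ### Automorphisms over the quotient -/

/-- A locally Noetherian scheme is integral near each point whose local ring is a domain: sections
over a small affine neighbourhood inject into the local ring. -/
theorem AlgebraicGeometry.Scheme.exists_isIntegral_opens {U : Scheme.{u}} [IsLocallyNoetherian U]
    (u : U) [IsDomain (U.presheaf.stalk u)] : ∃ V : U.Opens, u ∈ V ∧ IsIntegral V := by
  obtain ⟨V, hu, hV, hinj⟩ := U.exists_germ_injective u
  have hdom : IsDomain Γ(U, V) := hinj.isDomain (U.presheaf.germ V u hu).hom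
  have hdom' : IsDomain Γ(V, ⊤) := V.topIso.commRingCatIsoToRingEquiv.toMulEquiv.isDomain _
  have : IsAffine V := hV
  have : Nonempty V := ⟨⟨u, hu⟩⟩
  exact ⟨V, hu, isIntegral_of_isAffine_of_isDomain _⟩

theorem IsFiniteType.exists_isLocallyNoetherian {K : Type u} [Field K] {X : SchPresheaf.{u}}
    {sX : X ⟶ specP K} (hft : IsFiniteType sX) :
    ∃ (U : Scheme.{u}) (f : yoneda.obj U ⟶ X), IsEtaleAtlas f ∧ IsLocallyNoetherian U := by
  obtain ⟨U, f, g, hf, -, hg, -⟩ := hft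
  exact ⟨U, f, hf, LocallyOfFiniteType.isLocallyNoetherian g⟩

/-- A normal space of finite type over a field is étale locally integral. -/
theorem IsNormalSpace.exists_isIntegral_chart {K : Type u} [Field K] {X : SchPresheaf.{u}}
    {sX : X ⟶ specP K} (hft : IsFiniteType sX) (hnormal : IsNormalSpace X) (x : Points X) :
    ∃ (U : Scheme.{u}) (f : yoneda.obj U ⟶ X), IsEtaleMap f ∧ AlgebraicGeometry.IsIntegral U ∧
      x ∈ Set.range (Points.ofScheme f) := by
  obtain ⟨U, f, hf, hU⟩ := hft.exists_isLocallyNoetherian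
  obtain ⟨u, rfl⟩ := hf.surjective x
  have := (hnormal U f hf.isEtaleMap u).1
  obtain ⟨V, hu, hV⟩ := Scheme.exists_isIntegral_opens u
  exact ⟨V, _, hf.isEtaleMap.comp V.ι, hV, ⟨u, hu⟩, Points.ofScheme_map _ _ _⟩

/-- A nonempty integral étale chart of `X` lying over an affine étale chart of `Q`. -/
theorem IsNormalSpace.exists_isIntegral_chart_over_affine {K : Type u} [Field K]
    {X Q : SchPresheaf.{u}} {sX : X ⟶ specP K} (hft : IsFiniteType sX) (hnormal : IsNormalSpace X)
    [Nonempty (Points X)] (hQ : IsAlgebraicSpace Q) (π : X ⟶ Q) :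
    ∃ (V W : Scheme.{u}) (f : yoneda.obj V ⟶ X) (f₁ : yoneda.obj W ⟶ Q) (r : V ⟶ W),
      IsEtaleMap f ∧ AlgebraicGeometry.IsIntegral V ∧ IsEtaleMap f₁ ∧ IsAffine W ∧
      f ≫ π = yoneda.map r ≫ f₁ := by
  obtain ⟨U, f, hf, hU⟩ := hft.exists_isLocallyNoetherian
  obtain ⟨u, -⟩ := hf.surjective (Classical.arbitrary _)
  obtain ⟨U₁, f₁, hf₁⟩ := hQ.exists_atlas
  obtain ⟨u₁, hu₁⟩ := hf₁.surjective (Points.ofScheme (f ≫ π) u)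
  obtain ⟨R, r, s, hR, hs⟩ := hf₁.isEtaleMap.exists_pullback (f ≫ π)
  obtain ⟨z, -, -⟩ := Points.exists_of_ofScheme_eq hR hu₁
  obtain ⟨W, hW, hz, -⟩ := exists_isAffineOpen_mem_and_subset (x := r z) (U := ⊤) trivial
  have : Etale ((r ⁻¹ᵁ W).ι ≫ s) := inferInstance
  have : IsLocallyNoetherian (r ⁻¹ᵁ W) :=
    LocallyOfFiniteType.isLocallyNoetherian ((r ⁻¹ᵁ W).ι ≫ s)
  have hR' : IsEtaleMap (yoneda.map ((r ⁻¹ᵁ W).ι ≫ s) ≫ f) := hf.isEtaleMap.comp _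
  have := (hnormal _ _ hR' (⟨z, hz⟩ : r ⁻¹ᵁ W)).1
  obtain ⟨V, hzV, hV⟩ := Scheme.exists_isIntegral_opens (U := (r ⁻¹ᵁ W).toScheme) ⟨z, hz⟩
  refine ⟨V, W, _, _, V.ι ≫ r ∣_ W, hR'.comp V.ι, hV, hf₁.isEtaleMap.comp W.ι, hW, ?_⟩
  have h1 : (r ∣_ W) ≫ W.ι = (r ⁻¹ᵁ W).ι ≫ r := morphismRestrict_ι r W
  simp only [Functor.map_comp, Category.assoc, ← hR.w]
  rw [← Functor.map_comp_assoc yoneda (r ∣_ W), h1, Functor.map_comp_assoc]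

/-- For `X` connected, normal, separated and of finite type over `K`, every automorphism of `X` over
`X/G` lies in `G`: by connectedness it agrees with a single element of `G` everywhere, since the
locus where it agrees with a given element is open and closed. -/
theorem IsQuotientBy.mem_of_hom_comp_eq {K : Type u} [Field K] {X : SchPresheaf.{u}}
    {sX : X ⟶ specP K} (hX : IsAlgebraicSpace X) (hsep : IsSeparatedOver sX)
    (hft : IsFiniteType sX) (hconn : ConnectedSpace (Points X)) (hnormal : IsNormalSpace X)
    {G : Subgroup (Aut X)} (hG : G ≤ autOver sX) [Finite G] {Q : SchPresheaf.{u}} {π : X ⟶ Q}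
    (hπ : IsQuotientBy G π) {h : Aut X} (hK : h ∈ autOver sX) (hh : h.hom ≫ π = π) : h ∈ G := by
  have := hconn.toNonempty
  obtain ⟨V, W, f, f₁, r, hf, hV, hf₁, hW, hw⟩ :=
    hnormal.exists_isIntegral_chart_over_affine hft hπ.isAlgebraicSpace π
  have hT := hπ.affine.rep.isPullback f₁
  obtain ⟨g, hg⟩ := hπ.exists_eq_of_isIntegral hf₁ hT hh (hπ.affine.rep.lift f r hw)
  rw [hπ.affine.rep.lift_fst] at hg
  have hsg : h.hom ≫ sX = (g : Aut X).hom ≫ sX :=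
    (show h.hom ≫ sX = sX from hK).trans (show (g : Aut X).hom ≫ sX = sX from hG g.2).symm
  have hclopen : IsClopen (agreeLocus h.hom (g : Aut X).hom) :=
    ⟨isClosed_agreeLocus hsep hsg (hnormal.exists_isIntegral_chart hft), isOpen_agreeLocus⟩
  have huniv := hclopen.eq_univ ⟨_, V, f, hf, hg, Classical.arbitrary V, rfl⟩
  have : h = g := Iso.ext (eq_of_agreeLocus_eq_univ hX huniv)
  exact this ▸ g.2

/-! ### Descent along the separable closure -/

section Descent

variable (k : Type u) {K : Type u} [Field k] [Field K] [Algebra k K]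

/-- Two embeddings of a separable closure of `k` that agree on `k` differ by a Galois element. -/
theorem IsSepClosure.exists_comp_algEquiv_eq [IsSepClosure k K] {M : Type*} [Field M]
    {a b : K →+* M} (h : a.comp (algebraMap k K) = b.comp (algebraMap k K)) :
    ∃ σ : K ≃ₐ[k] K, b = a.comp (σ : K →+* K) := by
  have : IsGalois k K := IsSepClosure.isGalois
  let : Algebra K M := a.toAlgebra
  let : Algebra k M := (a.comp (algebraMap k K)).toAlgebra
  have : IsScalarTower k K M := .of_algebraMap_eq' rfl
  let b' : K →ₐ[k] M := { b with commutes' := fun x => (RingHom.congr_fun h x).symm }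
  let σ : K →ₐ[k] K := b'.restrictNormal K
  refine ⟨AlgEquiv.ofBijective σ (Algebra.IsAlgebraic.algHom_bijective σ), RingHom.ext fun x => ?_⟩
  exact (b'.restrictNormal_commutes K x).symm

theorem CategoryTheory.IsPullback.isClosed_map_image_of_isAlgebraic [Algebra.IsAlgebraic k K]
    {Q Y : SchPresheaf.{u}} {q : Q ⟶ Y} {sQ : Q ⟶ specP K} {sY : Y ⟶ specP k}
    (h : IsPullback q sQ sY (specPMap (algebraMap k K))) {C : Set (Points Q)} (hC : IsClosed C) :
    IsClosed (Points.map q '' C) := by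
  have hi : IsIntegralHom (Spec.map (CommRingCat.ofHom (algebraMap k K))) :=
    IsIntegralHom.SpecMap_iff.2 (algebraMap_isIntegral_iff.2 inferInstance)
  have hq : MorphismProperty.presheaf (@IsIntegralHom) q :=
    (MorphismProperty.relative_isStableUnderBaseChange (F := yoneda) @IsIntegralHom).of_isPullback
      h.flip (MorphismProperty.relative_map (P := @IsIntegralHom) hi)
  exact Points.isClosed_map_image hq.rep (fun _ _ p v f _ hT => hq.property f p v hT) hC

variable {X Q : SchPresheaf.{u}} {sX : X ⟶ specP K} {G : Subgroup (Aut X)} {π : X ⟶ Q}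
  {sQ : Q ⟶ specP K}

/-- A semilinear automorphism `φ` of `X` over `Y` normalizes `G`: the conjugate of an element of
`G` by `φ` is `K`-linear and lies over `Y`, hence over `X/G = Y_K`. -/
theorem TwistedQuotient.mem_normalizerOver (hsQ : π ≫ sQ = sX) (hG : G ≤ autOver sX)
    (hπ : ∀ g ∈ G, g.hom ≫ π = π)
    (hmem : ∀ h : Aut X, h ∈ autOver sX → h.hom ≫ π = π → h ∈ G)
    (Y : TwistedQuotient k sX π sQ) (σ : K ≃ₐ[k] K) {φ : Aut X}
    (hφ : φ.hom ≫ sX = sX ≫ specPMap (σ : K →+* K))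
    (hφY : φ.hom ≫ π ≫ Y.fromQuotient = π ≫ Y.fromQuotient) : φ ∈ normalizerOver k sX G := by
  have hinv : φ.inv ≫ φ.hom = 𝟙 X := φ.inv_hom_id
  have hinv' : φ.hom ≫ φ.inv = 𝟙 X := φ.hom_inv_id
  have hφY' : φ.inv ≫ π ≫ Y.fromQuotient = π ≫ Y.fromQuotient := by
    rw [← hφY, reassoc_of% hinv, hφY]
  have hover : ∀ h : Aut X, h ∈ autOver sX → h.hom ≫ π ≫ Y.fromQuotient = π ≫ Y.fromQuotient →
      h ∈ G := fun h hK hY => hmem h hK <| by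
    refine Y.isPullback.hom_ext (by simpa using hY) ?_
    rw [Category.assoc, hsQ]
    exact hK
  have hgY : ∀ g ∈ G, g.hom ≫ π ≫ Y.fromQuotient = π ≫ Y.fromQuotient := fun g hg => by
    rw [reassoc_of% hπ g hg]
  have hgK : ∀ g ∈ G, g.hom ≫ sX = sX := fun g hg => hG hg
  have hσ : specPMap (σ : K →+* K) ≫ specPMap (σ.symm : K →+* K) = 𝟙 _ := by
    rw [← specPMap_comp]
    have : (σ : K →+* K).comp (σ.symm : K →+* K) = RingHom.id K :=
      RingHom.ext fun x => σ.apply_symm_apply x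
    rw [this]
    simp [specPMap]
  refine ⟨Subgroup.mem_normalizer_iff.2 fun g => ⟨fun hg => ?_, fun hg => ?_⟩, ?_⟩
  · have e : (φ * g * φ⁻¹).hom = φ.inv ≫ g.hom ≫ φ.hom := rfl
    refine hover _ ?_ ?_
    · change (φ * g * φ⁻¹).hom ≫ sX = sX
      rw [e, Category.assoc, Category.assoc, hφ, reassoc_of% hgK g hg, ← hφ, reassoc_of% hinv]
    · rw [e, Category.assoc, Category.assoc, hφY, hgY g hg, hφY']
  · have e : g.hom = φ.hom ≫ (φ * g * φ⁻¹).hom ≫ φ.inv := by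
      change g.hom = φ.hom ≫ (φ.inv ≫ g.hom ≫ φ.hom) ≫ φ.inv
      simp only [Category.assoc, hinv', reassoc_of% hinv', Category.comp_id]
    have hφinv : φ.inv ≫ sX = sX ≫ specPMap (σ.symm : K →+* K) := by
      rw [← Iso.cancel_iso_hom_left (φ : X ≅ X), reassoc_of% hinv', reassoc_of% hφ, hσ,
        Category.comp_id]
    refine hover _ ?_ ?_
    · change g.hom ≫ sX = sX
      rw [e, Category.assoc, Category.assoc, hφinv, reassoc_of% hgK _ hg, reassoc_of% hφ, hσ,
        Category.comp_id]
    · rw [e, Category.assoc, Category.assoc, hφY', hgY _ hg, hφY]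
  · have e : (σ : K →+* K).comp (algebraMap k K) = algebraMap k K := RingHom.ext σ.commutes
    change φ.hom ≫ sX ≫ specPMap (algebraMap k K) = sX ≫ specPMap (algebraMap k K)
    rw [reassoc_of% hφ, ← specPMap_comp, e]

/-- The image of a distinguished subset descends: the Galois group acts transitively on the fibres
of `|X/G| ⟶ |Y|`, through automorphisms of `X` that preserve `Z`. -/
theorem TwistedQuotient.descends_image [IsSepClosure k K] (hsQ : π ≫ sQ = sX)
    (Y : TwistedQuotient k sX π sQ) {Z : Set (Points X)}
    (hclosed : IsClosed (Points.map π '' Z))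
    (hZ : ∀ (σ : K ≃ₐ[k] K) (φ : Aut X), φ.hom ≫ sX = sX ≫ specPMap (σ : K →+* K) →
      φ.hom ≫ π ≫ Y.fromQuotient = π ≫ Y.fromQuotient → Points.map φ.hom '' Z ⊆ Z) :
    Y.Descends k (Points.map π '' Z) := by
  have : IsGalois k K := IsSepClosure.isGalois
  refine ⟨_, Y.isPullback.isClosed_map_image_of_isAlgebraic k hclosed, ?_⟩
  refine Set.Subset.antisymm ?_ (Set.subset_preimage_image _ _)
  rintro c ⟨_, ⟨z, hz, rfl⟩, hzc⟩
  obtain ⟨L, _, x, rfl⟩ := Points.exists_rep z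
  obtain ⟨L', _, y, rfl⟩ := Points.exists_rep c
  rw [Points.map_map] at hzc
  obtain ⟨M, _, i, j, h⟩ := Points.exists_common_rep _ _ x y hzc
  rw [Points.mk_eq_mk_comp i] at hz
  rw [Points.mk_eq_mk_comp j]
  generalize specPMap i ≫ x = x' at h hz
  generalize specPMap j ≫ y = y' at h
  -- the two structures of `K`-algebra on `M` given by `x'` and `y'`
  obtain ⟨a, ha⟩ : ∃ a : K →+* M, x' ≫ sX = specPMap a := by
    obtain ⟨t, ht⟩ := yoneda.map_surjective (x' ≫ sX)
    obtain ⟨t, rfl⟩ := Spec.map_surjective t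
    exact ⟨t.hom, ht.symm⟩
  obtain ⟨b, hb⟩ : ∃ b : K →+* M, y' ≫ sQ = specPMap b := by
    obtain ⟨t, ht⟩ := yoneda.map_surjective (y' ≫ sQ)
    obtain ⟨t, rfl⟩ := Spec.map_surjective t
    exact ⟨t.hom, ht.symm⟩
  have hab : a.comp (algebraMap k K) = b.comp (algebraMap k K) := by
    have h1 : specPMap (a.comp (algebraMap k K)) = specPMap (b.comp (algebraMap k K)) := by
      rw [specPMap_comp, specPMap_comp, ← ha, ← hb, ← hsQ]
      simp only [Category.assoc]
      rw [← Y.isPullback.w, ← reassoc_of% h]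
    have h2 := Spec.map_injective (yoneda.map_injective h1)
    exact congrArg CommRingCat.Hom.hom h2
  obtain ⟨σ, rfl⟩ := IsSepClosure.exists_comp_algEquiv_eq k hab
  obtain ⟨φ, hφ, hφY⟩ := Y.exists_semilinear σ
  refine ⟨_, hZ σ φ hφ hφY ⟨_, hz, rfl⟩, ?_⟩
  rw [Points.map_mk, Points.map_mk]
  have key : (x' ≫ φ.hom) ≫ π = y' := by
    refine Y.isPullback.hom_ext ?_ ?_
    · rw [Category.assoc, Category.assoc, hφY, h]
    · rw [Category.assoc, Category.assoc, hsQ, hφ, reassoc_of% ha, hb, specPMap_comp]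
  rw [key]

end Descent

/-! ### Descent of distinguished subsets and fixed loci -/

theorem mainTheorem5 {k K : Type u} [Field k] [Field K] [Algebra k K] [IsSepClosure k K]
    -- `X` is a separated, connected, normal algebraic space of finite type over `K`
    (X : SchPresheaf.{u}) (sX : X ⟶ specP K) (hX : IsAlgebraicSpace X)
    (hsep : IsSeparatedOver sX) (hft : IsFiniteType sX)
    (hconn : ConnectedSpace (Points X)) (hnormal : IsNormalSpace X)
    -- `G` is a finite group of `K`-automorphisms of `X`, and `π : X ⟶ Q` is the quotient by `G`
    (G : Subgroup (Aut X)) (hG : G ≤ autOver sX) [Finite G]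
    (Q : SchPresheaf.{u}) (π : X ⟶ Q) (hπ : IsQuotientBy G π)
    (sQ : Q ⟶ specP K) (hsQ : π ≫ sQ = sX) :
    (∀ Z : Set (Points X), IsDistinguished k sX G Z →
      ∀ Y : TwistedQuotient k sX π sQ, Y.Descends k (Points.map π '' Z)) ∧
    (∀ H : Subgroup G,
      (IsDistinguished k sX G (⋃ H' ∈ subgroupOrbit k sX G H, fixedLocus H') ∧
        ∀ Y : TwistedQuotient k sX π sQ,
          Y.Descends k (Points.map π '' ⋃ H' ∈ subgroupOrbit k sX G H, fixedLocus H')) ∧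
      (IsDistinguished k sX G (⋂ H' ∈ subgroupOrbit k sX G H, fixedLocus H') ∧
        ∀ Y : TwistedQuotient k sX π sQ,
          Y.Descends k (Points.map π '' ⋂ H' ∈ subgroupOrbit k sX G H, fixedLocus H'))) := by
  have hZ : ∀ Z : Set (Points X), IsDistinguished k sX G Z →
      ∀ Y : TwistedQuotient k sX π sQ, Y.Descends k (Points.map π '' Z) := fun Z hZ Y =>
    Y.descends_image k hsQ (hπ.isClosed_image hZ.1) fun σ φ hφ hφY =>
      (hZ.2 φ (Y.mem_normalizerOver k hsQ hG hπ.invariant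
        (fun h => hπ.mem_of_hom_comp_eq hX hsep hft hconn hnormal hG) σ hφ hφY)).subset
  have hUnion := isDistinguished_iUnion_fixedLocus k hsep hG
  have hInter := isDistinguished_iInter_fixedLocus k hsep hG
  exact ⟨hZ, fun H => ⟨⟨hUnion H, hZ _ (hUnion H)⟩, ⟨hInter H, hZ _ (hInter H)⟩⟩⟩
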